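/- Let $(R,\mathfrak m,k)$ be a Noetherian local ring with embedding dimension $e=\dim_k(\mathfrak m/\mathfrak m^2)$ and codepth $c=e-\operatorname{depth}R$, and assume $c>0$. Let $\underline{x}=x_1,\dots,x_e$ be a minimal generating set of $\mathfrak m$. For a finitely generated $R$-module $M$ put $\mathrm h_i(M)=\dim_k \mathrm H_i(\underline{x};M)$, where $\mathrm H_i(\underline{x};M)$ is the $i$-th Koszul homology of $M$ with respect to $\underline{x}$. Put $\tilde{\mathrm h}_0(R)=0$ and $\tilde{\mathrm h}_i(R)=\mathrm h_i(R)$ for $i>0$. Let $$\cdots\to R^{\beta_2(k)}\xrightarrow{d_2}R^{\beta_1(k)}\xrightarrow{d_1}R^{\beta_0(k)}\to k\to 0$$ be a minimal free resolution of $k$, let $\Omega_0k=k$ and $\Omega_nk=\operatorname{Im}(d_n)$ for $n\ge 1$, and put $\beta_{-a}(k)=0$ for $a>0$. Let $\binom{e}{n}=0$ for $n>e$. (1) For every $n\ge 0$, $$\beta_n(k)\le\sum_{j=1}^{c}\beta_{n-j-1}(k)\,\mathrm h_j(R)+\binom{e}{n}.\qquad(\ast)$$ (2) For every fixed $n\ge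 0$ the following conditions are equivalent: (a) Equality holds in $(\ast)$. (b) For every $i=0,\dots,n-1$, $$\mathrm h_i(\Omega_{n-i}k)=\begin{cases}\mathrm h_1(\Omega_{n-1}k)&(i=0),\\ \beta_{n-i-1}(k)\,\mathrm h_i(R)+\mathrm h_{i+1}(\Omega_{n-i-1}k)&(i>0).\end{cases}$$ (c) For every $i=0,\dots,n-1$, $$\mathrm h_i(\Omega_{n-i}k)=\sum_{j=i}^{c}\beta_{n-j-1}(k)\,\tilde{\mathrm h}_j(R)+\binom{e}{n},$$ where the sum is $0$ if $i>c$. -/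

import Mathlib

open CategoryTheory IsLocalRing
open scoped TensorProduct

universe u

noncomputable section

namespace KoszulSyzygy

section Koszul

variable {R : Type u} [CommRing R] {e : ℕ}

/-- The linear form `R^e → R` sending the `j`-th basis vector to `x j`. -/
def koszulForm (x : Fin e → R) : Module.Dual R (Fin e → R) :=
  Fintype.linearCombination R x

theorem koszulForm_single (x : Fin e → R) (j : Fin e) :
    koszulForm x (Pi.single j 1) = x j := by
  simp [koszulForm]

theorem ι_mul_mem {i : ℕ} (v : Fin e → R) {a : ExteriorAlgebra R (Fin e → R)}
    (ha : a ∈ ⋀[R]^i (Fin e → R)) :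
    ExteriorAlgebra.ι R v * a ∈ ⋀[R]^(i + 1) (Fin e → R) := by
  have hv : ExteriorAlgebra.ι R v ∈ ⋀[R]^1 (Fin e → R) := by
    simp [ExteriorAlgebra.exteriorPower]
  have := SetLike.mul_mem_graded hv ha
  rwa [add_comm] at this

theorem contractLeft_mem (f : Module.Dual R (Fin e → R)) (i : ℕ) :
    ∀ a ∈ ⋀[R]^(i + 1) (Fin e → R),
      CliffordAlgebra.contractLeft (Q := 0) f a ∈ ⋀[R]^i (Fin e → R) := by
  have key : ∀ (i : ℕ) (v : Fin (i + 1) → (Fin e → R)),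
      CliffordAlgebra.contractLeft (Q := 0) f (ExteriorAlgebra.ιMulti R (i + 1) v) ∈
        ⋀[R]^i (Fin e → R) := by
    intro i
    induction i with
    | zero =>
      intro v
      rw [ExteriorAlgebra.ιMulti_succ_apply, ExteriorAlgebra.ιMulti_zero_apply, mul_one]
      erw [CliffordAlgebra.contractLeft_ι]
      exact SetLike.algebraMap_mem_graded (fun i : ℕ => ⋀[R]^i (Fin e → R)) _
    | succ i ih =>
      intro v
      rw [ExteriorAlgebra.ιMulti_succ_apply]
      erw [CliffordAlgebra.contractLeft_ι_mul]
      refine Submodule.sub_mem _ (Submodule.smul_mem _ _ ?_) ?_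
      · exact ExteriorAlgebra.ιMulti_range R (i + 1) (Set.mem_range_self _)
      · exact ι_mul_mem _ (ih _)
  intro a ha
  rw [← ExteriorAlgebra.ιMulti_span_fixedDegree] at ha
  induction ha using Submodule.span_induction with
  | mem a h => obtain ⟨v, rfl⟩ := h; exact key i v
  | zero => simp
  | add a b _ _ ha hb => rw [map_add]; exact add_mem ha hb
  | smul r a _ ha => rw [map_smul]; exact Submodule.smul_mem _ _ ha

/-- The Koszul differential `⋀^(i+1) R^e → ⋀^i R^e`, that is, contraction with the linear form
`e_j ↦ x j`; it sends `v_0 ∧ ⋯ ∧ v_i` to `∑ (-1)^j x(v_j) v_0 ∧ ⋯ ∧ v̂_j ∧ ⋯ ∧ v_i`. -/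
def koszulD (x : Fin e → R) (i : ℕ) : ⋀[R]^(i + 1) (Fin e → R) →ₗ[R] ⋀[R]^i (Fin e → R) :=
  (CliffordAlgebra.contractLeft (Q := 0) (koszulForm x)).restrict
    (contractLeft_mem (koszulForm x) i)

theorem koszulD_koszulD (x : Fin e → R) (i : ℕ) : koszulD x i ∘ₗ koszulD x (i + 1) = 0 := by
  refine LinearMap.ext fun a => Subtype.ext ?_
  exact CliffordAlgebra.contractLeft_contractLeft (Q := 0) (koszulForm x) _

/-- Left multiplication by the `j`-th basis vector of `R^e` on the exterior algebra. -/
def koszulWedge (j : Fin e) (i : ℕ) : ⋀[R]^i (Fin e → R) →ₗ[R] ⋀[R]^(i + 1) (Fin e → R) :=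
  (LinearMap.mulLeft R (ExteriorAlgebra.ι R (Pi.single j (1 : R)))).restrict
    fun _ ha => ι_mul_mem _ ha

theorem koszulD_koszulWedge (x : Fin e → R) (j : Fin e) (i : ℕ) (a : ⋀[R]^(i + 1) (Fin e → R)) :
    koszulD x (i + 1) (koszulWedge j (i + 1) a) + koszulWedge j i (koszulD x i a) = x j • a := by
  ext1
  have := CliffordAlgebra.contractLeft_ι_mul (Q := (0 : QuadraticForm R (Fin e → R)))
    (d := koszulForm x) (Pi.single j 1) a.1
  rw [koszulForm_single] at this
  exact (eq_sub_iff_add_eq.mp this)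

theorem koszulD_koszulWedge_zero (x : Fin e → R) (j : Fin e) (a : ⋀[R]^0 (Fin e → R)) :
    koszulD x 0 (koszulWedge j 0 a) = x j • a := by
  ext1
  have := CliffordAlgebra.contractLeft_ι_mul (Q := (0 : QuadraticForm R (Fin e → R)))
    (d := koszulForm x) (Pi.single j 1) a.1
  rw [koszulForm_single] at this
  have h0 : CliffordAlgebra.contractLeft (Q := (0 : QuadraticForm R (Fin e → R)))
      (koszulForm x) a.1 = 0 := by
    obtain ⟨r, hr⟩ := Submodule.mem_one.mp (show a.1 ∈ (1 : Submodule R _) from a.2)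
    rw [← hr]
    exact CliffordAlgebra.contractLeft_algebraMap _ _ r
  rw [h0, mul_zero, sub_zero] at this
  exact this

/-- The Koszul complex `K_•(x; M) = K_•(x) ⊗ M` with `K_i(x) = ⋀^i R^e`. -/
def koszulComplex (x : Fin e → R) (M : Type u) [AddCommGroup M] [Module R M] :
    ChainComplex (ModuleCat.{u} R) ℕ :=
  ChainComplex.of (fun i => ModuleCat.of R ((⋀[R]^i (Fin e → R)) ⊗[R] M))
    (fun i => ModuleCat.ofHom ((koszulD x i).rTensor M))
    (fun i => by
      rw [← ModuleCat.ofHom_comp, ← LinearMap.rTensor_comp, koszulD_koszulD,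
        LinearMap.rTensor_zero]
      rfl)

/-- Koszul homology `H_i(x; M)`. -/
abbrev koszulHomology (x : Fin e → R) (M : Type u) [AddCommGroup M] [Module R M] (i : ℕ) :
    ModuleCat.{u} R :=
  (koszulComplex x M).homology i

theorem koszulComplex_d (x : Fin e → R) (M : Type u) [AddCommGroup M] [Module R M] (i : ℕ) :
    (koszulComplex x M).d (i + 1) i = ModuleCat.ofHom ((koszulD x i).rTensor M) :=
  ChainComplex.of_d (fun i => ModuleCat.of R ((⋀[R]^i (Fin e → R)) ⊗[R] M))
    (fun i => ModuleCat.ofHom ((koszulD x i).rTensor M)) i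

/-- The maps `e_j ∧ -` on the Koszul complex. -/
def koszulHomotopyMap (x : Fin e → R) (M : Type u) [AddCommGroup M] [Module R M] (j : Fin e)
    (i i' : ℕ) (h : (ComplexShape.down ℕ).Rel i' i) :
    (koszulComplex x M).X i ⟶ (koszulComplex x M).X i' :=
  ModuleCat.ofHom ((koszulWedge j i).rTensor M) ≫
    eqToHom (congrArg (koszulComplex x M).X (show i + 1 = i' from h))

theorem koszulHomotopyMap_eq (x : Fin e → R) (M : Type u) [AddCommGroup M] [Module R M]
    (j : Fin e) :
    x j • 𝟙 (koszulComplex x M) = Homotopy.nullHomotopicMap' (koszulHomotopyMap x M j) := by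
  ext i : 1
  cases i with
  | zero =>
    rw [Homotopy.nullHomotopicMap'_f_of_not_rel_left (k₁ := 1) (k₀ := 0) (by simp) (by simp)]
    rw [koszulComplex_d]
    apply ModuleCat.hom_ext
    refine TensorProduct.ext' fun a m => ?_
    change x j • (a ⊗ₜ[R] m) = koszulD x 0 (koszulWedge j 0 a) ⊗ₜ[R] m
    rw [koszulD_koszulWedge_zero, TensorProduct.smul_tmul']
  | succ i =>
    rw [Homotopy.nullHomotopicMap'_f (k₂ := i + 2) (k₁ := i + 1) (k₀ := i) (by simp) (by simp)]
    rw [koszulComplex_d, koszulComplex_d]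
    apply ModuleCat.hom_ext
    refine TensorProduct.ext' fun a m => ?_
    change x j • (a ⊗ₜ[R] m) = koszulWedge j i (koszulD x i a) ⊗ₜ[R] m +
      koszulD x (i + 1) (koszulWedge j (i + 1) a) ⊗ₜ[R] m
    rw [← TensorProduct.add_tmul, add_comm (koszulWedge j i _), koszulD_koszulWedge,
      TensorProduct.smul_tmul']

/-- Koszul homology is annihilated by the ideal generated by `x`. -/
theorem koszulHomology_isTorsionBySet (x : Fin e → R) (M : Type u) [AddCommGroup M] [Module R M]
    (i : ℕ) : Module.IsTorsionBySet R (koszulHomology x M i) (Ideal.span (Set.range x)) := by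
  rw [← Module.isTorsionBySet_iff_is_torsion_by_span]
  rintro a ⟨_, j, rfl⟩
  have h : HomologicalComplex.homologyMap (x j • 𝟙 (koszulComplex x M)) i = 0 := by
    rw [((Homotopy.ofEq (koszulHomotopyMap_eq x M j)).trans
      (Homotopy.nullHomotopy' _)).homologyMap_eq i, HomologicalComplex.homologyMap_zero]
  have h2 : HomologicalComplex.homologyMap (x j • 𝟙 (koszulComplex x M)) i =
      x j • 𝟙 ((koszulComplex x M).homology i) := by
    rw [← cancel_epi ((koszulComplex x M).homologyπ i), HomologicalComplex.homologyπ_naturality,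
      Linear.comp_smul, Category.comp_id]
    have : HomologicalComplex.cyclesMap (x j • 𝟙 (koszulComplex x M)) i =
        x j • 𝟙 ((koszulComplex x M).cycles i) := by
      rw [← cancel_mono ((koszulComplex x M).iCycles i), HomologicalComplex.cyclesMap_i,
        Linear.smul_comp, Category.id_comp, HomologicalComplex.smul_f_apply,
        HomologicalComplex.id_f, Linear.comp_smul, Category.comp_id]
    rw [this, Linear.smul_comp, Category.id_comp]
  rw [h2] at h
  exact congrArg (fun f => ModuleCat.Hom.hom f a) h

end Koszul

section Local

variable (R : Type u) [CommRing R] [IsLocalRing R]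

/-- The embedding dimension `dim_k (𝔪 / 𝔪²)`. -/
def embDim : ℕ :=
  Module.finrank (ResidueField R) (CotangentSpace R)

/-- The depth of `R`: the supremum of the lengths of `R`-regular sequences in `𝔪`. For a
Noetherian local ring these lengths are bounded by the Krull dimension. -/
def depth : ℕ :=
  sSup {n : ℕ | ∃ rs : List R, rs.length = n ∧ (∀ r ∈ rs, r ∈ maximalIdeal R) ∧
    RingTheory.Sequence.IsRegular R rs}

/-- The codepth `edim R - depth R`. -/
def codepth : ℕ :=
  embDim R - depth R

variable {R}

/-- If `x` generates `𝔪`, the Koszul homology `H_i(x; M)` is a vector space over `k = R/𝔪`,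
with the scalar action induced by that of `R`. -/
abbrev koszulHomologyModule {e : ℕ} (x : Fin e → R)
    (hx : Ideal.span (Set.range x) = maximalIdeal R)
    (M : Type u) [AddCommGroup M] [Module R M] (i : ℕ) :
    Module (ResidueField R) (koszulHomology x M i) :=
  Module.IsTorsionBySet.module (I := maximalIdeal R)
    (hx ▸ koszulHomology_isTorsionBySet x M i)

/-- `h_i(M) = dim_k H_i(x; M)`, where `x` generates `𝔪`. -/
def koszulDim {e : ℕ} (x : Fin e → R) (hx : Ideal.span (Set.range x) = maximalIdeal R)
    (M : Type u) [AddCommGroup M] [Module R M] (i : ℕ) : ℕ :=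
  letI := koszulHomologyModule x hx M i
  Module.finrank (ResidueField R) (koszulHomology x M i)

/-- `h̃_i(R)`, which is `0` for `i = 0` and `h_i(R)` for `i > 0`. -/
def koszulDimTilde {e : ℕ} (x : Fin e → R) (hx : Ideal.span (Set.range x) = maximalIdeal R)
    (i : ℕ) : ℕ :=
  if i = 0 then 0 else koszulDim x hx R i

variable (R)

/-- A minimal free resolution
`⋯ → R^{rank 2} → R^{rank 1} → R^{rank 0} → M → 0`
of an `R`-module `M` by free modules of finite rank: an exact sequence in which the image of
each differential `d n : R^{rank (n+1)} → R^{rank n}` lies in `𝔪 R^{rank n}`. -/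
structure MinimalFreeResolution (M : Type u) [AddCommGroup M] [Module R M] where
  rank : ℕ → ℕ
  d : ∀ n, (Fin (rank (n + 1)) → R) →ₗ[R] (Fin (rank n) → R)
  augmentation : (Fin (rank 0) → R) →ₗ[R] M
  augmentation_surjective : Function.Surjective augmentation
  exact_zero : Function.Exact (d 0) augmentation
  exact_succ : ∀ n, Function.Exact (d (n + 1)) (d n)
  minimal : ∀ n, LinearMap.range (d n) ≤ maximalIdeal R • ⊤

namespace MinimalFreeResolution

variable {R} {M : Type u} [AddCommGroup M] [Module R M] (F : MinimalFreeResolution R M)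

/-- The Betti numbers `β_i(M)` for `i : ℤ`, with `β_i(M) = 0` for `i < 0`. -/
def betti : ℤ → ℕ
  | Int.ofNat n => F.rank n
  | Int.negSucc _ => 0

/-- The syzygies of `M`: `syz 0 = M`, and `syz (n+1)` is the image of
`d n : R^{rank (n+1)} → R^{rank n}`. -/
def syz : ℕ → ModuleCat.{u} R
  | 0 => ModuleCat.of R M
  | n + 1 => ModuleCat.of R (LinearMap.range (F.d n))

end MinimalFreeResolution

end Local

end KoszulSyzygy

end

noncomputable section

namespace KoszulSyzygy

/-! Minimality of the resolution gives short exact sequences 0 → Ω_{m+1} → R^{β_m} → Ω_m → 0 whose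
first map has image in 𝔪R^{β_m}. The long exact sequence of Koszul homology yields h_i(Ω_{m+1}) ≤
β_m h_i(R) + h_{i+1}(Ω_m). For i = 0 the map H_0(Ω_{m+1}) → H_0(R^{β_m}) vanishes, so the term β_m
h_0(R) drops out; this is what h̃ records (`koszulDim_syz_succ_le_tilde`).

Put a_i = h_i(Ω_{n-i}). Then a_0 = β_n, because H_0 of a syzygy counts minimal generators, and a_n =
h_n(k) = binom(e, n), because the Koszul differential on k is zero. Chaining a_i ≤ b_i + a_{i+1}
from 0 to n gives (∗). Equality at the end forces equality at every step, which is the equivalence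
(`le_sum_and_tfae_of_le_add`). The sums may stop at c because Koszul homology of R vanishes above e
- depth R (`koszulDim_self_eq_zero`).

Inequalities are proved for `Module.length` over R, which takes values in `ℕ∞` and needs no
finiteness, and are moved to k-dimensions by `coe_koszulDim`. -/

theorem length_le_add_of_exact {R A B C : Type*} [Ring R] [AddCommGroup A] [AddCommGroup B]
    [AddCommGroup C] [Module R A] [Module R B] [Module R C] (f : A →ₗ[R] B) (g : B →ₗ[R] C)
    (h : Function.Exact f g) :
    Module.length R B ≤ Module.length R A + Module.length R C := by
  rw [Module.length_eq_add_of_exact (LinearMap.ker g).subtype g.rangeRestrict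
    (Submodule.subtype_injective _) g.surjective_rangeRestrict
    (by intro b; simp [← LinearMap.mem_ker])]
  refine add_le_add ?_ (Module.length_le_of_injective _ (Submodule.subtype_injective _))
  rw [LinearMap.exact_iff.mp h]
  exact Module.length_le_of_surjective f.rangeRestrict f.surjective_rangeRestrict

/-! ### Functoriality of Koszul homology, the long exact sequence, and H_0 -/

section Functoriality

variable {R : Type u} [CommRing R] {e : ℕ} (x : Fin e → R)
variable {M N L : Type u} [AddCommGroup M] [Module R M] [AddCommGroup N] [Module R N]
  [AddCommGroup L] [Module R L]

theorem smul_koszulHomology_eq_zero {r : R} (hr : r ∈ Ideal.span (Set.range x)) {i : ℕ}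
    (z : koszulHomology x M i) : r • z = 0 := by
  have h := koszulHomology_isTorsionBySet x M i
  exact @h z ⟨r, hr⟩

/-- The chain map `K_•(x; M) → K_•(x; N)` induced by a linear map. -/
def koszulMap (f : M →ₗ[R] N) : koszulComplex x M ⟶ koszulComplex x N where
  f i := ModuleCat.ofHom (f.lTensor (⋀[R]^i (Fin e → R)))
  comm' i j hij := by
    obtain rfl : j + 1 = i := hij
    rw [koszulComplex_d, koszulComplex_d]
    apply ModuleCat.hom_ext
    exact TensorProduct.ext' fun a m => rfl

/-- The map `H_i(x; M) → H_i(x; N)` induced by a linear map. -/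
def koszulHomologyMap (f : M →ₗ[R] N) (i : ℕ) :
    koszulHomology x M i →ₗ[R] koszulHomology x N i :=
  (HomologicalComplex.homologyMap (koszulMap x f) i).hom

theorem koszulMap_smul_id (r : R) :
    koszulMap x (r • (LinearMap.id : M →ₗ[R] M)) = r • 𝟙 (koszulComplex x M) := by
  ext i : 1
  apply ModuleCat.hom_ext
  refine TensorProduct.ext' fun a m => ?_
  change a ⊗ₜ[R] (r • m) = r • (a ⊗ₜ[R] m)
  rw [TensorProduct.tmul_smul]

/-- Multiplication by r on M induces multiplication by r on homology, which (x) annihilates. This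
makes the long exact sequence of a regular element split into short pieces. -/
theorem koszulHomologyMap_smul_id {r : R} (hr : r ∈ Ideal.span (Set.range x)) (i : ℕ) :
    koszulHomologyMap x (r • (LinearMap.id : M →ₗ[R] M)) i = 0 := by
  ext a
  have h2 : HomologicalComplex.homologyMap (r • 𝟙 (koszulComplex x M)) i =
      r • 𝟙 ((koszulComplex x M).homology i) := by
    rw [← cancel_epi ((koszulComplex x M).homologyπ i), HomologicalComplex.homologyπ_naturality,
      Linear.comp_smul, Category.comp_id]
    have : HomologicalComplex.cyclesMap (r • 𝟙 (koszulComplex x M)) i =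
        r • 𝟙 ((koszulComplex x M).cycles i) := by
      rw [← cancel_mono ((koszulComplex x M).iCycles i), HomologicalComplex.cyclesMap_i,
        Linear.smul_comp, Category.id_comp, HomologicalComplex.smul_f_apply,
        HomologicalComplex.id_f, Linear.comp_smul, Category.comp_id]
    rw [this, Linear.smul_comp, Category.id_comp]
  rw [koszulHomologyMap, koszulMap_smul_id, h2]
  exact smul_koszulHomology_eq_zero x hr a

variable {f : N →ₗ[R] M} {g : M →ₗ[R] L}

/-- The short complex of Koszul complexes induced by a complex `N → M → L`. -/
def koszulShortComplex (h : Function.Exact f g) :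
    ShortComplex (ChainComplex (ModuleCat.{u} R) ℕ) :=
  ShortComplex.mk (koszulMap x f) (koszulMap x g) (by
    ext i : 1
    apply ModuleCat.hom_ext
    refine TensorProduct.ext' fun a m => ?_
    change a ⊗ₜ[R] g (f m) = 0
    rw [h.apply_apply_eq_zero, TensorProduct.tmul_zero])

theorem koszulShortComplex_shortExact (hf : Function.Injective f) (hg : Function.Surjective g)
    (h : Function.Exact f g) : (koszulShortComplex x h).ShortExact := by
  refine HomologicalComplex.shortExact_of_degreewise_shortExact _ fun i => ?_
  refine ModuleCat.shortComplex_shortExact _ ?_ ?_ ?_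
  · exact lTensor_exact (⋀[R]^i (Fin e → R)) h hg
  · exact Module.Flat.lTensor_preserves_injective_linearMap (M := ⋀[R]^i (Fin e → R)) f hf
  · exact LinearMap.lTensor_surjective (⋀[R]^i (Fin e → R)) hg

theorem koszulHomologyMap_exact (hf : Function.Injective f) (hg : Function.Surjective g)
    (h : Function.Exact f g) (i : ℕ) :
    Function.Exact (koszulHomologyMap x f i) (koszulHomologyMap x g i) :=
  (ShortComplex.ShortExact.moduleCat_exact_iff_function_exact _).mp
    ((koszulShortComplex_shortExact x hf hg h).homology_exact₂ i)

theorem exists_koszulHomology_connecting (hf : Function.Injective f) (hg : Function.Surjective g)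
    (h : Function.Exact f g) (i : ℕ) :
    ∃ δ : koszulHomology x L (i + 1) →ₗ[R] koszulHomology x N i,
      Function.Exact δ (koszulHomologyMap x f i) :=
  ⟨((koszulShortComplex_shortExact x hf hg h).δ (i + 1) i rfl).hom,
    (ShortComplex.ShortExact.moduleCat_exact_iff_function_exact _).mp
      ((koszulShortComplex_shortExact x hf hg h).homology_exact₁ (i + 1) i rfl)⟩

theorem isIso_iCycles_zero (M : Type u) [AddCommGroup M] [Module R M] :
    IsIso ((koszulComplex x M).iCycles 0) :=
  (koszulComplex x M).isIso_iCycles 0 0 (by simp) ((koszulComplex x M).shape _ _ (by simp))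

/-- The projection from `K_0(x; M)` onto `H_0(x; M)`. -/
def koszulClassZero (M : Type u) [AddCommGroup M] [Module R M] :
    ((⋀[R]^0 (Fin e → R)) ⊗[R] M) →ₗ[R] koszulHomology x M 0 :=
  haveI := isIso_iCycles_zero x M
  (inv ((koszulComplex x M).iCycles 0) ≫ (koszulComplex x M).homologyπ 0).hom

theorem koszulClassZero_surjective : Function.Surjective (koszulClassZero x M) := by
  have : IsIso ((koszulComplex x M).iCycles 0) := isIso_iCycles_zero x M
  exact (ModuleCat.epi_iff_surjective _).mp (epi_comp _ _)

theorem koszulHomologyMap_koszulClassZero (f : N →ₗ[R] M)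
    (a : (⋀[R]^0 (Fin e → R)) ⊗[R] N) :
    koszulHomologyMap x f 0 (koszulClassZero x N a) = koszulClassZero x M (f.lTensor _ a) := by
  have (M : Type u) [AddCommGroup M] [Module R M] := isIso_iCycles_zero x M
  have : (inv ((koszulComplex x N).iCycles 0) ≫ (koszulComplex x N).homologyπ 0) ≫
      HomologicalComplex.homologyMap (koszulMap x f) 0 = (koszulMap x f).f 0 ≫
        (inv ((koszulComplex x M).iCycles 0) ≫ (koszulComplex x M).homologyπ 0) := by
    rw [Category.assoc, HomologicalComplex.homologyπ_naturality, IsIso.inv_comp_eq,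
      ← HomologicalComplex.cyclesMap_i_assoc, IsIso.hom_inv_id_assoc]
  exact congrArg (fun φ => ModuleCat.Hom.hom φ a) this

theorem koszulHomologyMap_zero_surjective (hg : Function.Surjective g) :
    Function.Surjective (koszulHomologyMap x g 0) := by
  intro z
  obtain ⟨a, rfl⟩ := koszulClassZero_surjective x z
  obtain ⟨b, rfl⟩ := LinearMap.lTensor_surjective (⋀[R]^0 (Fin e → R)) hg a
  exact ⟨_, koszulHomologyMap_koszulClassZero x g b⟩

/-- A class of H_0 lying in the image of f is represented by tensors c ⊗ f(n) with f(n) ∈ (x)M;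
scalars from (x) come out and kill the class. This is where minimality of a resolution enters. -/
theorem koszulHomologyMap_zero_eq_zero
    (hf : LinearMap.range f ≤ Ideal.span (Set.range x) • ⊤) : koszulHomologyMap x f 0 = 0 := by
  have key (c : ⋀[R]^0 (Fin e → R)) (m : M)
      (hm : m ∈ Ideal.span (Set.range x) • (⊤ : Submodule R M)) :
      koszulClassZero x M (c ⊗ₜ m) = 0 := by
    induction hm using Submodule.smul_induction_on' with
    | smul r hr n _ =>
      rw [TensorProduct.tmul_smul, map_smul]
      exact smul_koszulHomology_eq_zero x hr _
    | add m _ n _ hm hn => rw [TensorProduct.tmul_add, map_add, hm, hn, add_zero]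
  ext z
  obtain ⟨a, rfl⟩ := koszulClassZero_surjective x z
  rw [koszulHomologyMap_koszulClassZero, LinearMap.zero_apply]
  induction a with
  | zero => simp
  | add a b ha hb => rw [map_add, map_add, ha, hb, add_zero]
  | tmul c n => exact key c (f n) (hf ⟨n, rfl⟩)

end Functoriality

/-! ### Length estimates, Koszul homology of special modules, depth sensitivity -/

section Length

variable {R : Type u} [CommRing R] {e : ℕ} (x : Fin e → R)
variable {M N L : Type u} [AddCommGroup M] [Module R M] [AddCommGroup N] [Module R N]
  [AddCommGroup L] [Module R L] {f : N →ₗ[R] M} {g : M →ₗ[R] L}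

theorem length_koszulHomology_le_middle (hf : Function.Injective f) (hg : Function.Surjective g)
    (h : Function.Exact f g) (i : ℕ) :
    Module.length R (koszulHomology x M i) ≤
      Module.length R (koszulHomology x N i) + Module.length R (koszulHomology x L i) :=
  length_le_add_of_exact _ _ (koszulHomologyMap_exact x hf hg h i)

theorem length_koszulHomology_le_left (hf : Function.Injective f) (hg : Function.Surjective g)
    (h : Function.Exact f g) (i : ℕ) :
    Module.length R (koszulHomology x N i) ≤
      Module.length R (koszulHomology x L (i + 1)) + Module.length R (koszulHomology x M i) :=
  let ⟨_, hδ⟩ := exists_koszulHomology_connecting x hf hg h i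
  length_le_add_of_exact _ _ hδ

/-- Since H_0(f) = 0, exactness makes the connecting map H_1(L) → H_0(N) surjective. -/
theorem length_koszulHomology_zero_le (hf : Function.Injective f) (hg : Function.Surjective g)
    (h : Function.Exact f g) (hmin : LinearMap.range f ≤ Ideal.span (Set.range x) • ⊤) :
    Module.length R (koszulHomology x N 0) ≤ Module.length R (koszulHomology x L 1) := by
  obtain ⟨δ, hδ⟩ := exists_koszulHomology_connecting x hf hg h 0
  rw [koszulHomologyMap_zero_eq_zero x hmin] at hδ
  exact Module.length_le_of_surjective δ fun z => (hδ z).mp rfl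

theorem length_koszulHomology_zero_eq (hf : Function.Injective f) (hg : Function.Surjective g)
    (h : Function.Exact f g) (hmin : LinearMap.range f ≤ Ideal.span (Set.range x) • ⊤) :
    Module.length R (koszulHomology x M 0) = Module.length R (koszulHomology x L 0) := by
  have hex := koszulHomologyMap_exact x hf hg h 0
  rw [koszulHomologyMap_zero_eq_zero x hmin] at hex
  refine (LinearEquiv.ofBijective (koszulHomologyMap x g 0) ⟨?_, ?_⟩).length_eq
  · refine (injective_iff_map_eq_zero _).mpr fun z hz => ?_
    obtain ⟨_, rfl⟩ := (hex z).mp hz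
    rfl
  · exact koszulHomologyMap_zero_surjective x hg

theorem subsingleton_koszulHomology_of_subsingleton (i : ℕ)
    [Subsingleton ((⋀[R]^i (Fin e → R)) ⊗[R] M)] : Subsingleton (koszulHomology x M i) := by
  have : Limits.IsZero ((koszulComplex x M).X i) :=
    ModuleCat.isZero_of_subsingleton (ModuleCat.of R ((⋀[R]^i (Fin e → R)) ⊗[R] M))
  exact ModuleCat.subsingleton_of_isZero (ShortComplex.isZero_homology_of_isZero_X₂ _ this)

/-- Induction on β, splitting off one coordinate; an upper bound suffices, so additivity of homology
is not needed. -/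
theorem length_koszulHomology_pi_le (β i : ℕ) :
    Module.length R (koszulHomology x (Fin β → R) i) ≤
      β * Module.length R (koszulHomology x R i) := by
  induction β with
  | zero =>
    have := subsingleton_koszulHomology_of_subsingleton x (M := Fin 0 → R) i
    rw [Module.length_eq_zero]
    exact zero_le
  | succ β ih =>
    have key := length_koszulHomology_le_middle x (N := R) (M := Fin (β + 1) → R)
      (L := Fin β → R) (f := LinearMap.single R (fun _ => R) 0)
      (g := LinearMap.funLeft R R Fin.succ) (Pi.single_injective (M := fun _ : Fin (β + 1) => R) 0)
      (LinearMap.funLeft_surjective_of_injective _ _ _ (Fin.succ_injective _)) (by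
        intro v
        constructor
        · intro hv
          refine ⟨v 0, funext fun j => ?_⟩
          refine Fin.cases (by simp) (fun k => ?_) j
          simpa using (congrFun hv k).symm
        · rintro ⟨r, rfl⟩
          ext k
          simp [LinearMap.funLeft_apply]) i
    refine key.trans ?_
    push_cast
    rw [add_mul, one_mul, add_comm]
    gcongr

theorem length_exteriorPower_tensor [Nontrivial R] (i : ℕ) :
    Module.length R ((⋀[R]^i (Fin e → R)) ⊗[R] M) = e.choose i * Module.length R M := by
  let b : (⋀[R]^i (Fin e → R)) ≃ₗ[R] (Fin (e.choose i) → R) :=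
    LinearEquiv.ofFinrankEq _ _ (by simp [exteriorPower.finrank_eq])
  rw [((TensorProduct.congr b (LinearEquiv.refl R M)).trans
    ((TensorProduct.comm R _ _).trans
      (TensorProduct.piScalarRight R R M (Fin (e.choose i))))).length_eq]
  simp

/-- The differential is linear in x, so after tensoring with a module killed by every x_j it
vanishes. -/
theorem koszulD_eq_sum (i : ℕ) :
    koszulD x i = ∑ j, x j • koszulD (Pi.single j 1) i := by
  have : koszulForm x = ∑ j, x j • koszulForm (Pi.single j 1) := by
    refine LinearMap.ext fun v => ?_
    simp [koszulForm, Fintype.linearCombination_apply, mul_comm, Finset.sum_apply, Pi.single_apply]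
  refine LinearMap.ext fun a => Subtype.ext ?_
  change CliffordAlgebra.contractLeft (Q := 0) (koszulForm x) a.1 = _
  rw [this]
  simp only [map_sum, map_smul, LinearMap.sum_apply, LinearMap.smul_apply]
  rw [AddSubmonoidClass.coe_finsetSum]
  rfl

theorem koszulComplex_d_eq_zero (hM : ∀ j (m : M), x j • m = 0) (i j : ℕ) :
    (koszulComplex x M).d i j = 0 := by
  by_cases hij : (ComplexShape.down ℕ).Rel i j
  · obtain rfl : j + 1 = i := hij
    rw [koszulComplex_d, koszulD_eq_sum]
    apply ModuleCat.hom_ext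
    refine TensorProduct.ext' fun a m => ?_
    change (∑ k, x k • koszulD (Pi.single k 1) j) a ⊗ₜ[R] m = 0
    simp [LinearMap.sum_apply, TensorProduct.sum_tmul, TensorProduct.smul_tmul, hM]
  · exact (koszulComplex x M).shape _ _ hij

theorem length_koszulHomology_of_smul_eq_zero [Nontrivial R] (hM : ∀ j (m : M), x j • m = 0)
    (i : ℕ) : Module.length R (koszulHomology x M i) = e.choose i * Module.length R M := by
  rw [← length_exteriorPower_tensor]
  exact (ShortComplex.LeftHomologyData.ofZeros ((koszulComplex x M).sc i)
    (koszulComplex_d_eq_zero x hM _ _)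
    (koszulComplex_d_eq_zero x hM _ _)).homologyIso.toLinearEquiv.length_eq

/-- Depth sensitivity. For r regular on M, the sequence H_{i+1}(M/rM) → H_i(M) → H_i(M) has second
map multiplication by r, which is zero, so vanishing for M/rM in degree i + 1 gives vanishing for M
in degree i. The induction ends with the empty sequence, where ⋀^i R^e = 0 for i > e. -/
theorem subsingleton_koszulHomology_of_isWeaklyRegular [Nontrivial R] (rs : List R)
    (hrs : ∀ r ∈ rs, r ∈ Ideal.span (Set.range x)) :
    ∀ (M : Type u) [AddCommGroup M] [Module R M], RingTheory.Sequence.IsWeaklyRegular M rs →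
      ∀ i, e < i + rs.length → Subsingleton (koszulHomology x M i) := by
  induction rs with
  | nil =>
    intro M _ _ _ i hi
    have : Subsingleton ((⋀[R]^i (Fin e → R)) ⊗[R] M) := by
      rw [← Module.length_eq_zero_iff (R := R), length_exteriorPower_tensor,
        Nat.choose_eq_zero_of_lt (by simpa using hi), Nat.cast_zero, zero_mul]
    exact subsingleton_koszulHomology_of_subsingleton x i
  | cons r rs ih =>
    intro M _ _ hreg i hi
    obtain ⟨hr, hreg⟩ := (RingTheory.Sequence.isWeaklyRegular_cons_iff M r rs).mp hreg
    have h1 := ih (fun s hs => hrs s (List.mem_cons_of_mem _ hs)) (QuotSMulTop r M) hreg (i + 1)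
      (by rw [List.length_cons] at hi; omega)
    obtain ⟨δ, hδ⟩ := exists_koszulHomology_connecting x (f := r • (LinearMap.id : M →ₗ[R] M))
      (L := QuotSMulTop r M)
      (g := Submodule.mkQ _) hr (Submodule.mkQ_surjective _) (by
        intro m
        rw [Submodule.mkQ_apply, Submodule.Quotient.mk_eq_zero]
        simp [Submodule.mem_smul_pointwise_iff_exists]) i
    rw [koszulHomologyMap_smul_id x (hrs r List.mem_cons_self)] at hδ
    refine ⟨fun a b => ?_⟩
    obtain ⟨a, rfl⟩ := (hδ a).mp rfl
    obtain ⟨b, rfl⟩ := (hδ b).mp rfl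
    rw [Subsingleton.elim a b]

theorem finite_koszulHomology [IsNoetherianRing R] [Module.Finite R M] (i : ℕ) :
    Module.Finite R (koszulHomology x M i) := by
  have : Module.Finite R ((koszulComplex x M).X i) :=
    inferInstanceAs (Module.Finite R ((⋀[R]^i (Fin e → R)) ⊗[R] M))
  have : Module.Finite R ((koszulComplex x M).cycles i) :=
    Module.Finite.of_injective ((koszulComplex x M).iCycles i).hom
      ((ModuleCat.mono_iff_injective _).mp inferInstance)
  exact Module.Finite.of_surjective ((koszulComplex x M).homologyπ i).hom
    ((ModuleCat.epi_iff_surjective _).mp inferInstance)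

end Length

/-! ### Local rings: dimensions over the residue field -/

section LocalRing

variable {R : Type u} [CommRing R] [IsLocalRing R] {e : ℕ} (x : Fin e → R)
  (hx : Ideal.span (Set.range x) = maximalIdeal R)

theorem coe_koszulDim [IsNoetherianRing R] (M : Type u) [AddCommGroup M] [Module R M]
    [Module.Finite R M] (i : ℕ) :
    (koszulDim x hx M i : ℕ∞) = Module.length R (koszulHomology x M i) := by
  let := koszulHomologyModule x hx M i
  have : IsScalarTower R (ResidueField R) (koszulHomology x M i) :=
    Module.IsTorsionBySet.isScalarTower (I := maximalIdeal R)
      (hx ▸ koszulHomology_isTorsionBySet x M i)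
  have := finite_koszulHomology x (M := M) i
  have : Module.Finite (ResidueField R) (koszulHomology x M i) :=
    Module.Finite.of_restrictScalars_finite R _ _
  rw [Module.length_eq_of_surjective (R := ResidueField R) (S := R)
    (M := koszulHomology x M i) IsLocalRing.residue_surjective, Module.length_eq_finrank]
  rfl

include hx in
theorem smul_residueField_eq_zero (j : Fin e) (a : ResidueField R) : x j • a = 0 := by
  have hj : x j ∈ maximalIdeal R := hx ▸ Ideal.subset_span (Set.mem_range_self j)
  rw [Algebra.smul_def, IsLocalRing.ResidueField.algebraMap_eq,
    (IsLocalRing.residue_eq_zero_iff _).mpr hj, zero_mul]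

theorem length_residueField : Module.length R (ResidueField R) = 1 := by
  rw [Module.length_eq_of_surjective (R := ResidueField R) (S := R)
    (M := ResidueField R) IsLocalRing.residue_surjective, Module.length_eq_one]

theorem koszulDim_residueField [IsNoetherianRing R] (i : ℕ) :
    koszulDim x hx (ResidueField R) i = e.choose i := by
  have := coe_koszulDim x hx (ResidueField R) i
  rw [length_koszulHomology_of_smul_eq_zero x (smul_residueField_eq_zero x hx),
    length_residueField, mul_one] at this
  exact_mod_cast this

theorem koszulDim_self_eq_zero (hc : 0 < e - depth R) (i : ℕ)
    (hi : e - depth R < i) : koszulDim x hx R i = 0 := by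
  obtain ⟨rs, hlen, hmem, hreg⟩ : ∃ rs : List R, e < i + rs.length ∧
      (∀ r ∈ rs, r ∈ maximalIdeal R) ∧ RingTheory.Sequence.IsWeaklyRegular R rs := by
    -- If the depth is 0, the empty sequence suffices, even if 0 is a default value of `sSup`. A
    -- positive `sSup` in ℕ comes from a nonempty bounded set, hence is attained.
    rcases Nat.eq_zero_or_pos (depth R) with h0 | hpos
    · exact ⟨[], by simp; omega, by simp, .nil R R⟩
    · have hne : {n : ℕ | ∃ rs : List R, rs.length = n ∧ (∀ r ∈ rs, r ∈ maximalIdeal R) ∧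
          RingTheory.Sequence.IsRegular R rs}.Nonempty := by
        refine Set.nonempty_iff_ne_empty.mpr fun h => ?_
        rw [depth, h, csSup_empty] at hpos
        exact lt_irrefl _ hpos
      obtain ⟨rs, hlen, hmem, hreg⟩ := Nat.sSup_mem hne
        (by_contra fun hb => hpos.ne' (Nat.sSup_of_not_bddAbove hb))
      change rs.length = depth R at hlen
      exact ⟨rs, by omega, hmem, hreg.toIsWeaklyRegular⟩
  have hs : Subsingleton (koszulHomology x R i) :=
    subsingleton_koszulHomology_of_isWeaklyRegular x rs (hx ▸ hmem) R hreg i hlen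
  let := koszulHomologyModule x hx R i
  exact Module.finrank_zero_of_subsingleton

include hx in
-- The kernel of R^β → k^β is 𝔪R^β, so H_0 does not change on passing to k^β, where the Koszul
-- differential is zero.
theorem length_koszulHomology_pi_zero (β : ℕ) :
    Module.length R (koszulHomology x (Fin β → R) 0) = β := by
  let g : (Fin β → R) →ₗ[R] (Fin β → ResidueField R) :=
    (Algebra.linearMap R (ResidueField R)).compLeft (Fin β)
  have hg : Function.Surjective g := by
    intro v
    choose w hw using fun j => IsLocalRing.residue_surjective (v j)
    exact ⟨w, funext hw⟩
  have hmin : LinearMap.range (LinearMap.ker g).subtype ≤ Ideal.span (Set.range x) • ⊤ := by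
    rw [Submodule.range_subtype, hx]
    intro v hv
    rw [pi_eq_sum_univ v]
    refine Submodule.sum_mem _ fun j _ => Submodule.smul_mem_smul ?_ trivial
    exact (IsLocalRing.residue_eq_zero_iff _).mp (congrFun hv j)
  rw [length_koszulHomology_zero_eq x (f := (LinearMap.ker g).subtype) (g := g)
    (Submodule.subtype_injective _) hg (LinearMap.exact_subtype_ker_map g) hmin,
    length_koszulHomology_of_smul_eq_zero x (M := Fin β → ResidueField R)
      fun j v => funext fun k => smul_residueField_eq_zero x hx j (v k)]
  simp [length_residueField]

end LocalRing

/-! ### Telescoping a chain of inequalities -/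

theorem le_sum_and_tfae_of_le_add (n : ℕ) (a b : ℕ → ℕ) (h : ∀ i < n, a i ≤ b i + a (i + 1)) :
    a 0 ≤ ∑ j ∈ Finset.Ico 0 n, b j + a n ∧
    List.TFAE [a 0 = ∑ j ∈ Finset.Ico 0 n, b j + a n,
      ∀ i < n, a i = b i + a (i + 1),
      ∀ i < n, a i = ∑ j ∈ Finset.Ico i n, b j + a n] := by
  have hle : ∀ i ∈ Finset.range n, a i ≤ b i + a (i + 1) := fun i hi => h i (Finset.mem_range.mp hi)
  have htel : ∑ i ∈ Finset.range n, a i + a n = ∑ i ∈ Finset.range n, a (i + 1) + a 0 := by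
    rw [← Finset.sum_range_succ, Finset.sum_range_succ']
  have hsum := Finset.sum_le_sum hle
  have hiff := Finset.sum_eq_sum_iff_of_le hle
  rw [Finset.sum_add_distrib] at hsum hiff
  rw [← Finset.range_eq_Ico]
  refine ⟨by omega, ?_⟩
  tfae_have 1 ↔ 2 := by
    simp only [Finset.mem_range] at hiff
    rw [← hiff]
    omega
  tfae_have 2 → 3 := by
    intro H i hi
    -- Allowing i = n, where the sum is empty, gives the base of the descending induction.
    replace hi := hi.le
    induction hi using Nat.decreasingInduction with
    | self => simp
    | of_succ k hk ih => rw [H k hk, Finset.sum_eq_sum_Ico_succ_bot hk, add_assoc, ih]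
  tfae_have 3 → 1 := by
    intro H
    -- Only the instance i = 0 is needed; for n = 0 there is none, but the equality is trivial.
    rcases Nat.eq_zero_or_pos n with rfl | hn
    · simp
    · rw [H 0 hn, Finset.range_eq_Ico]
  tfae_finish

section Exact

variable {R A B C : Type*} [Ring R] [AddCommGroup A] [AddCommGroup B] [AddCommGroup C]
  [Module R A] [Module R B] [Module R C] {f : A →ₗ[R] B} {g : B →ₗ[R] C}

theorem exact_subtype_range (h : Function.Exact f g) :
    Function.Exact (LinearMap.range f).subtype g := by
  rw [LinearMap.exact_iff, Submodule.range_subtype]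
  exact LinearMap.exact_iff.mp h

theorem exact_rangeRestrict (h : Function.Exact f g) : Function.Exact f g.rangeRestrict := by
  rw [LinearMap.exact_iff, LinearMap.ker_rangeRestrict]
  exact LinearMap.exact_iff.mp h

end Exact

/-! ### Syzygies and their Koszul homology -/

namespace MinimalFreeResolution

variable {R : Type u} [CommRing R] [IsLocalRing R] {M : Type u} [AddCommGroup M] [Module R M]
  (F : MinimalFreeResolution R M)

theorem exists_syz_shortExact (m : ℕ) :
    ∃ (f : F.syz (m + 1) →ₗ[R] (Fin (F.rank m) → R)) (g : (Fin (F.rank m) → R) →ₗ[R] F.syz m),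
      Function.Injective f ∧ Function.Surjective g ∧ Function.Exact f g ∧
        LinearMap.range f ≤ maximalIdeal R • ⊤ := by
  refine ⟨(LinearMap.range (F.d m)).subtype, ?_⟩
  have hmin : LinearMap.range (LinearMap.range (F.d m)).subtype ≤ maximalIdeal R • ⊤ := by
    rw [Submodule.range_subtype]
    exact F.minimal m
  cases m with
  | zero =>
    refine ⟨F.augmentation, Submodule.subtype_injective _, F.augmentation_surjective,
      exact_subtype_range F.exact_zero, hmin⟩
  | succ m =>
    refine ⟨(F.d m).rangeRestrict, Submodule.subtype_injective _,
      (F.d m).surjective_rangeRestrict,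
      exact_rangeRestrict (exact_subtype_range (F.exact_succ m)), hmin⟩

instance finite_syz (m : ℕ) : Module.Finite R (F.syz m) :=
  let ⟨_, g, _, hg, _⟩ := F.exists_syz_shortExact m
  Module.Finite.of_surjective g hg

theorem betti_natCast_sub (n i : ℕ) (hi : i < n) :
    F.betti ((n : ℤ) - i - 1) = F.rank (n - i - 1) := by
  have : (n : ℤ) - i - 1 = ((n - i - 1 : ℕ) : ℤ) := by omega
  rw [this]
  rfl

theorem betti_natCast_sub_eq_zero (n i : ℕ) (hi : n ≤ i) : F.betti ((n : ℤ) - i - 1) = 0 := by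
  have : (n : ℤ) - i - 1 = Int.negSucc (i - n) := by omega
  rw [this]
  rfl

variable {e : ℕ} (x : Fin e → R)
  (hx : Ideal.span (Set.range x) = maximalIdeal R)

/-- Terms with j ≥ n vanish because the Betti index is negative, and terms with j > e - depth R
vanish by depth sensitivity, so both sums reduce to their common range. -/
theorem sum_betti_mul_koszulDimTilde (n i : ℕ) (hc : 0 < e - depth R) :
    ∑ j ∈ Finset.Icc i (e - depth R), F.betti ((n : ℤ) - j - 1) * koszulDimTilde x hx j =
      ∑ j ∈ Finset.Ico i n, F.betti ((n : ℤ) - j - 1) * koszulDimTilde x hx j := by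
  rw [← Finset.sum_filter_of_ne (p := (· < n)), ← Finset.sum_filter_of_ne
    (s := Finset.Ico i n) (p := (· ≤ e - depth R))]
  · congr 1
    ext j
    simp only [Finset.mem_filter, Finset.mem_Icc, Finset.mem_Ico]
    tauto
  · intro j _ hj
    contrapose! hj
    rw [koszulDimTilde, koszulDim_self_eq_zero x hx hc j hj, ite_self, mul_zero]
  · intro j _ hj
    contrapose! hj
    rw [betti_natCast_sub_eq_zero F n j hj, zero_mul]

variable [IsNoetherianRing R]

theorem koszulDim_syz_zero (m : ℕ) : koszulDim x hx (F.syz m) 0 = F.rank m := by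
  obtain ⟨f, g, hf, hg, h, hmin⟩ := F.exists_syz_shortExact m
  have := length_koszulHomology_zero_eq x hf hg h (hx ▸ hmin)
  rw [length_koszulHomology_pi_zero x hx, ← coe_koszulDim x hx] at this
  exact_mod_cast this.symm

theorem koszulDim_syz_succ_zero_le (m : ℕ) :
    koszulDim x hx (F.syz (m + 1)) 0 ≤ koszulDim x hx (F.syz m) 1 := by
  obtain ⟨f, g, hf, hg, h, hmin⟩ := F.exists_syz_shortExact m
  have := length_koszulHomology_zero_le x hf hg h (hx ▸ hmin)
  rw [← coe_koszulDim x hx, ← coe_koszulDim x hx] at this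
  exact_mod_cast this

theorem koszulDim_syz_succ_le (m i : ℕ) :
    koszulDim x hx (F.syz (m + 1)) i ≤
      F.rank m * koszulDim x hx R i + koszulDim x hx (F.syz m) (i + 1) := by
  obtain ⟨f, g, hf, hg, h, -⟩ := F.exists_syz_shortExact m
  have := (length_koszulHomology_le_left x hf hg h i).trans
    (add_le_add_right (length_koszulHomology_pi_le x (F.rank m) i) _)
  rw [← coe_koszulDim x hx, ← coe_koszulDim x hx, ← coe_koszulDim x hx] at this
  rw [add_comm (F.rank m * _)]
  exact_mod_cast this

theorem koszulDim_syz_succ_le_tilde (m i : ℕ) :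
    koszulDim x hx (F.syz (m + 1)) i ≤
      F.rank m * koszulDimTilde x hx i + koszulDim x hx (F.syz m) (i + 1) := by
  rcases eq_or_ne i 0 with rfl | hi
  · simpa [koszulDimTilde] using F.koszulDim_syz_succ_zero_le x hx m
  · simpa [koszulDimTilde, hi] using F.koszulDim_syz_succ_le x hx m i

end MinimalFreeResolution

end KoszulSyzygy

end

/-! ### The main theorem -/

theorem mainTheorem7 {R : Type u} [CommRing R] [IsLocalRing R] [IsNoetherianRing R]
    (x : Fin (KoszulSyzygy.embDim R) → R)
    (hx : Ideal.span (Set.range x) = maximalIdeal R)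
    (F : KoszulSyzygy.MinimalFreeResolution R (ResidueField R))
    (hc : 0 < KoszulSyzygy.codepth R) (n : ℕ) :
    F.betti n ≤ (∑ j ∈ Finset.Icc 1 (KoszulSyzygy.codepth R),
        F.betti ((n : ℤ) - j - 1) * KoszulSyzygy.koszulDim x hx R j) +
          (KoszulSyzygy.embDim R).choose n ∧
    List.TFAE [
      F.betti n = (∑ j ∈ Finset.Icc 1 (KoszulSyzygy.codepth R),
        F.betti ((n : ℤ) - j - 1) * KoszulSyzygy.koszulDim x hx R j) +
          (KoszulSyzygy.embDim R).choose n,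
      ∀ i < n, KoszulSyzygy.koszulDim x hx (F.syz (n - i)) i =
        if i = 0 then KoszulSyzygy.koszulDim x hx (F.syz (n - 1)) 1
        else F.betti ((n : ℤ) - i - 1) * KoszulSyzygy.koszulDim x hx R i +
          KoszulSyzygy.koszulDim x hx (F.syz (n - i - 1)) (i + 1),
      ∀ i < n, KoszulSyzygy.koszulDim x hx (F.syz (n - i)) i =
        (∑ j ∈ Finset.Icc i (KoszulSyzygy.codepth R),
          F.betti ((n : ℤ) - j - 1) * KoszulSyzygy.koszulDimTilde x hx j) +
            (KoszulSyzygy.embDim R).choose n] := by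
  -- The chain is a_i = h_i(Ω_{n-i}) with increments b_j = β_{n-j-1} h̃_j(R); the step at i comes
  -- from the syzygy sequence with m = n - i - 1.
  have key := KoszulSyzygy.le_sum_and_tfae_of_le_add n
    (fun i => KoszulSyzygy.koszulDim x hx (F.syz (n - i)) i)
    (fun j => F.betti ((n : ℤ) - j - 1) * KoszulSyzygy.koszulDimTilde x hx j) (fun i hi => by
      have := F.koszulDim_syz_succ_le_tilde x hx (n - i - 1) i
      rwa [Nat.sub_add_cancel (by omega), ← F.betti_natCast_sub n i hi] at this)
  have hn : KoszulSyzygy.koszulDim x hx (F.syz (n - n)) n =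
      (KoszulSyzygy.embDim R).choose n := by
    rw [Nat.sub_self]
    exact KoszulSyzygy.koszulDim_residueField x hx n
  have h0 : KoszulSyzygy.koszulDim x hx (F.syz (n - 0)) 0 = F.betti n :=
    F.koszulDim_syz_zero x hx n
  have hsum : ∑ j ∈ Finset.Icc 1 (KoszulSyzygy.codepth R),
      F.betti ((n : ℤ) - j - 1) * KoszulSyzygy.koszulDim x hx R j =
      ∑ j ∈ Finset.Icc 0 (KoszulSyzygy.codepth R),
        F.betti ((n : ℤ) - j - 1) * KoszulSyzygy.koszulDimTilde x hx j := by
    -- The added term j = 0 is zero because h̃_0(R) = 0.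
    rw [← Finset.insert_Icc_add_one_left_eq_Icc (Nat.zero_le _), Finset.sum_insert (by simp)]
    simp only [KoszulSyzygy.koszulDimTilde, if_true, mul_zero, zero_add]
    refine Finset.sum_congr rfl fun j hj => ?_
    rw [if_neg (by have := (Finset.mem_Icc.mp hj).1; omega)]
  have hstep (i : ℕ) : (if i = 0 then KoszulSyzygy.koszulDim x hx (F.syz (n - 1)) 1
        else F.betti ((n : ℤ) - i - 1) * KoszulSyzygy.koszulDim x hx R i +
          KoszulSyzygy.koszulDim x hx (F.syz (n - i - 1)) (i + 1)) =
      F.betti ((n : ℤ) - i - 1) * KoszulSyzygy.koszulDimTilde x hx i +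
        KoszulSyzygy.koszulDim x hx (F.syz (n - (i + 1))) (i + 1) := by
    rcases eq_or_ne i 0 with rfl | hi
    · simp [KoszulSyzygy.koszulDimTilde]
    · rw [if_neg hi, KoszulSyzygy.koszulDimTilde, if_neg hi, Nat.sub_sub]
  have hIco (i : ℕ) := F.sum_betti_mul_koszulDimTilde x hx n i hc
  simp only [hn, h0] at key
  rw [hsum]
  simp only [hstep, KoszulSyzygy.codepth, hIco]
  exact key
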